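/- **Setting.** Let $X\in\mathbb R^{n\times p}$ be a fixed design and let $l(\eta;y)$ be a loss that is differentiable in $\eta\in\mathbb R^n$ with $1$-Lipschitz gradient: $\|\nabla l(\eta_1;y)-\nabla l(\eta_2;y)\|_2\le\|\eta_1-\eta_2\|_2$. Let $\beta^*\in\mathbb R^p$, $\gamma^*\in\mathbb R^n$ be deterministic, $s^*=\|\beta^*\|_0$, $o^*=\|\gamma^*\|_0$, and suppose that the effective noise $\epsilon=-\nabla l(X\beta^*+\gamma^*;y)$, random through the data $y$, is a mean-zero sub-Gaussian random vector with scale bounded by $\sigma\ge 0$: for each $a\in\mathbb R^n$, $\langle\epsilon,a\rangle$ has mean zero and sub-Gaussian tails, and $\inf\{K>0:\mathbb E\exp(\langle\epsilon,a\rangle^2/K^2)\le2\}\le\sigma\|a\|_2$. Write $\bar\beta=(\beta,\gamma)$, $\bar X\bar\beta=X\beta+\gamma$, $\bar X_\rho\bar\beta=X\beta/\sqrt\rho+\gamma$, $\mathbf D_2(a,b)=\|a-b\|_2^2/2$, $\Delta_l(a,b)=l(a;y)-l(b;y)-\langle\nabla l(b;y),a-b\rangle$, $\bar\Delta_l(a,b)=\{\Delta_l(a,b)+\Delta_l(b,a)\}/2$.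 Let $\Theta^{\#}(v;q)$ keep $q$ entries of $v$ that are largest in absolute value and set the others to $0$. Let $\rho>0$, $\vartheta\ge1$, let $q_\gamma=\vartheta o^*$ and $q_\beta=\vartheta s^*$ be integers, and let $\hat{\bar\beta}=(\hat\beta,\hat\gamma)$ be a (random) A-estimator, that is, almost surely $\|\hat\beta\|_0=q_\beta$, $\|\hat\gamma\|_0=q_\gamma$ and $$\hat\beta=\Theta^{\#}\big(\hat\beta-X^T\nabla l(X\hat\beta+\hat\gamma;y)/\rho;\,q_\beta\big),\qquad \hat\gamma=\Theta^{\#}\big(\hat\gamma-\nabla l(X\hat\beta+\hat\gamma;y);\,q_\gamma\big).$$ Put $E=\vartheta o^*\sigma^2\log\frac{en}{\vartheta o^*}+\vartheta s^*\sigma^2\log\frac{ep}{\vartheta s^*}+\sigma^2$, where a summand with $o^*=0$ or $s^*=0$ is $0$. **Theorem.** (i) There is a universal constant $C_1>0$ such that the following holds. If for some (nonrandom) $\delta>0$, almost surely, $$(2\bar\Delta_l-\delta\mathbf D_2)(\bar X_\rho\bar\beta,\bar X_\rho\bar\beta')\ \ge\ \tfrac1{\sqrt\vartheta}\,\mathbf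 D_2(\bar\beta,\bar\beta')$$ for all $\bar\beta,\bar\beta'$ with $\|\beta\|_0\le\vartheta s^*$, $\|\beta'\|_0\le s^*$, $\|\gamma\|_0\le\vartheta o^*$, $\|\gamma'\|_0\le o^*$, then $\mathbf D_2(\bar X\hat{\bar\beta},\bar X\bar\beta^*)$ is integrable and $$\mathbb E\,\mathbf D_2(\bar X\hat{\bar\beta},\bar X\bar\beta^*)\ \le\ \frac{C_1}{\delta^2}\,E.$$ (ii) For all constants $K,C>0$ there is a constant $C_2>0$, depending only on $K$ and $C$, such that the following holds. Let $1\le R<\infty$ and suppose that $\hat{\bar\beta}$ is, almost surely, a limit point of an alternating algorithm started at some $\bar\beta^{(0)}$ with $\|\beta^{(0)}\|_0\le q_\beta$, $\|\gamma^{(0)}\|_0\le q_\gamma$ and $\mathbb E\,\mathbf D_2(\bar X\bar\beta^{(0)},\bar X\bar\beta^*)\le K\,R\,E$. Here each update of the algorithm is an exact minimization of $l(X\beta+\gamma;y)$ over $\beta$ subject to $\|\beta\|_0\le q_\beta$ or over $\gamma$ subject to $\|\gamma\|_0\le q_\gamma$, or a quantile-thresholding step $\beta\leftarrow\Theta^{\#}(\beta-X^T\nabla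 l(X\beta+\gamma;y)/r;q_\beta)$ with some $r>0$ such that $\|Xb\|_2^2\le r\|b\|_2^2$ whenever $\|b\|_0\le 2q_\beta$, or $\gamma\leftarrow\Theta^{\#}(\gamma-\nabla l(X\beta+\gamma;y);q_\gamma)$, or any other update to a point with $\|\beta\|_0\le q_\beta$, $\|\gamma\|_0\le q_\gamma$ that does not increase the loss. If for some (nonrandom) $\delta>0$, almost surely, $$\Big\{2\Big(1-\frac1R\Big)\bar\Delta_l+\frac{C}{R(R\delta\vee1)}\Delta_l-\delta\mathbf D_2\Big\}(\bar X_\rho\bar\beta,\bar X_\rho\bar\beta')\ \ge\ \frac{1-1/R}{\sqrt\vartheta}\,\mathbf D_2(\bar\beta,\bar\beta')$$ for all $\bar\beta,\bar\beta'$ with the same sparsity as in (i), then again $\mathbf D_2(\bar X\hat{\bar\beta},\bar X\bar\beta^*)$ is integrable and $\mathbb E\,\mathbf D_2(\bar X\hat{\bar\beta},\bar X\bar\beta^*)\le \frac{C_2}{\delta^2}\,E$. -/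

import Mathlib

noncomputable section

namespace ResistantLearning

open MeasureTheory

/-- The number of nonzero entries of a vector. -/
def l0 {d : ℕ} (v : EuclideanSpace ℝ (Fin d)) : ℕ :=
  (Finset.univ.filter fun i => v i ≠ 0).card

/-- The systematic component `X β + γ`, i.e. the augmented design `[X  I]` applied to the
concatenation of `β` and `γ`. -/
def fit {n p : ℕ} (X : Matrix (Fin n) (Fin p) ℝ) (β : EuclideanSpace ℝ (Fin p))
    (γ : EuclideanSpace ℝ (Fin n)) : EuclideanSpace ℝ (Fin n) :=
  Matrix.toEuclideanLin X β + γ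

/-- Generalized Bregman function of `f`:
`Δ_f(a, b) = f a - f b - ⟨∇f b, a - b⟩`. -/
def breg {n : ℕ} (f : EuclideanSpace ℝ (Fin n) → ℝ) (a b : EuclideanSpace ℝ (Fin n)) : ℝ :=
  f a - f b - inner ℝ (gradient f b) (a - b)

/-- Symmetrized generalized Bregman function. -/
def symBreg {n : ℕ} (f : EuclideanSpace ℝ (Fin n) → ℝ) (a b : EuclideanSpace ℝ (Fin n)) : ℝ :=
  (breg f a b + breg f b a) / 2

/-- `D₂(a, b) = ‖a - b‖² / 2`. -/
def D2 {d : ℕ} (a b : EuclideanSpace ℝ (Fin d)) : ℝ := ‖a - b‖ ^ 2 / 2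

/-- `t` is a quantile thresholding of `s` at level `q`: it keeps `q` entries of `s` that are
largest in absolute value and sets all others to zero. When there is a tie at the threshold, every
choice of the `q` entries is accepted. -/
def IsQuantileThreshold {d : ℕ} (s : EuclideanSpace ℝ (Fin d)) (q : ℕ)
    (t : EuclideanSpace ℝ (Fin d)) : Prop :=
  ∃ J : Finset (Fin d), J.card = min q d ∧
    (∀ i ∈ J, ∀ j ∉ J, |s j| ≤ |s i|) ∧
    (∀ i ∈ J, t i = s i) ∧ (∀ i ∉ J, t i = 0)

/-- The pair of quantile-thresholding fixed-point equations, for the loss `f` on the systematic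
component and inverse stepsize `ρ`. -/
def IsThresholdFixedPoint {n p : ℕ} (X : Matrix (Fin n) (Fin p) ℝ)
    (f : EuclideanSpace ℝ (Fin n) → ℝ) (ρ : ℝ) (qβ qγ : ℕ)
    (β : EuclideanSpace ℝ (Fin p)) (γ : EuclideanSpace ℝ (Fin n)) : Prop :=
  IsQuantileThreshold
      (β - (1 / ρ) • Matrix.toEuclideanLin X.transpose (gradient f (fit X β γ))) qβ β ∧
    IsQuantileThreshold (γ - gradient f (fit X β γ)) qγ γ

/-- The `ψ₂`-norm `inf {K > 0 : E exp(ξ² / K²) ≤ 2}`, with value `∞` if there is no such `K`. -/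
def psi2Norm {Ω : Type*} [MeasurableSpace Ω] (μ : Measure Ω) (ξ : Ω → ℝ) : ENNReal :=
  ⨅ (K : ℝ) (_ : 0 < K) (_ : ∫⁻ ω, ENNReal.ofReal (Real.exp (ξ ω ^ 2 / K ^ 2)) ∂μ ≤ 2),
    ENNReal.ofReal K

/-- Mean-zero sub-Gaussian random variable. -/
structure IsSubGaussian {Ω : Type*} [MeasurableSpace Ω] (μ : Measure Ω) (ξ : Ω → ℝ) : Prop where
  integrable : Integrable ξ μ
  mean_zero : ∫ ω, ξ ω ∂μ = 0
  tail : ∃ C c : ℝ, 0 < C ∧ 0 < c ∧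
    ∀ t : ℝ, 0 < t → μ {ω | t ≤ |ξ ω|} ≤ ENNReal.ofReal (C * Real.exp (-c * t ^ 2))

/-- Mean-zero sub-Gaussian random vector with scale bounded by `σ`. -/
structure IsSubGaussianVector {Ω : Type*} [MeasurableSpace Ω] (μ : Measure Ω) {n : ℕ}
    (ε : Ω → EuclideanSpace ℝ (Fin n)) (σ : ℝ) : Prop where
  aemeasurable : AEMeasurable ε μ
  marginal : ∀ a : EuclideanSpace ℝ (Fin n), IsSubGaussian μ fun ω => inner ℝ (ε ω) a
  scale : ∀ a : EuclideanSpace ℝ (Fin n),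
    psi2Norm μ (fun ω => inner ℝ (ε ω) a) ≤ ENNReal.ofReal (σ * ‖a‖)

/-- `u σ² log (e n / u) + v σ² log (e p / v) + σ²`; a summand with `u = 0` or `v = 0` is `0`. -/
def riskRate (n p : ℕ) (σ u v : ℝ) : ℝ :=
  u * σ ^ 2 * Real.log (Real.exp 1 * n / u) + v * σ ^ 2 * Real.log (Real.exp 1 * p / v) + σ ^ 2

/-- One update of an alternating algorithm for minimizing `f (X β + γ)` under the constraints
`‖β‖₀ ≤ qβ`, `‖γ‖₀ ≤ qγ`. -/
inductive Update {n p : ℕ} (X : Matrix (Fin n) (Fin p) ℝ)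
    (f : EuclideanSpace ℝ (Fin n) → ℝ) (qβ qγ : ℕ) :
    EuclideanSpace ℝ (Fin p) × EuclideanSpace ℝ (Fin n) →
    EuclideanSpace ℝ (Fin p) × EuclideanSpace ℝ (Fin n) → Prop
  /-- exact minimization over `β` -/
  | betaMin (β β' γ) (hs : l0 β' ≤ qβ)
      (hmin : ∀ b, l0 b ≤ qβ → f (fit X β' γ) ≤ f (fit X b γ)) :
      Update X f qβ qγ (β, γ) (β', γ)
  /-- exact minimization over `γ` -/
  | gammaMin (β γ γ') (hs : l0 γ' ≤ qγ)
      (hmin : ∀ g, l0 g ≤ qγ → f (fit X β γ') ≤ f (fit X β g)) :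
      Update X f qβ qγ (β, γ) (β, γ')
  /-- quantile-thresholding update of `β`, with an inverse stepsize `r` that is at least the
  restricted isometry constant of `X` of order `2 qβ` -/
  | betaThreshold (β β' γ) (r : ℝ) (hr : 0 < r)
      (hrip : ∀ b : EuclideanSpace ℝ (Fin p), l0 b ≤ 2 * qβ →
        ‖Matrix.toEuclideanLin X b‖ ^ 2 ≤ r * ‖b‖ ^ 2)
      (h : IsQuantileThreshold
        (β - (1 / r) • Matrix.toEuclideanLin X.transpose (gradient f (fit X β γ))) qβ β') :
      Update X f qβ qγ (β, γ) (β', γ)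
  /-- quantile-thresholding update of `γ` -/
  | gammaThreshold (β γ γ')
      (h : IsQuantileThreshold (γ - gradient f (fit X β γ)) qγ γ') :
      Update X f qβ qγ (β, γ) (β, γ')
  /-- any other feasible update that does not increase the loss, such as one found by line search -/
  | monotone (β β' γ γ') (hβ : l0 β' ≤ qβ) (hγ : l0 γ' ≤ qγ)
      (hle : f (fit X β' γ') ≤ f (fit X β γ)) :
      Update X f qβ qγ (β, γ) (β', γ')

/-- `(β, γ)` is a limit point of an alternating algorithm started at `(β₀, γ₀)`. -/
def IsReachedFrom {n p : ℕ} (X : Matrix (Fin n) (Fin p) ℝ)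
    (f : EuclideanSpace ℝ (Fin n) → ℝ) (qβ qγ : ℕ)
    (β₀ : EuclideanSpace ℝ (Fin p)) (γ₀ : EuclideanSpace ℝ (Fin n))
    (β : EuclideanSpace ℝ (Fin p)) (γ : EuclideanSpace ℝ (Fin n)) : Prop :=
  ∃ z : ℕ → EuclideanSpace ℝ (Fin p) × EuclideanSpace ℝ (Fin n),
    z 0 = (β₀, γ₀) ∧ (∀ t, Update X f qβ qγ (z t) (z (t + 1))) ∧
    MapClusterPt (β, γ) Filter.atTop z

/-- The regularity condition on the rescaled augmented design `[X/√ρ  I]`, with weights `a` on the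
doubled symmetrized Bregman function and `w` on the Bregman function:
`(2 a Δ̄_f + w Δ_f - δ D₂)(·, ·) ≥ (a / √ϑ) D₂((β, γ), (β', γ'))`
for all `‖β‖₀ ≤ ϑ s`, `‖β'‖₀ ≤ s`, `‖γ‖₀ ≤ ϑ o`, `‖γ'‖₀ ≤ o`. -/
def RegularityCondition {n p : ℕ} (X : Matrix (Fin n) (Fin p) ℝ)
    (f : EuclideanSpace ℝ (Fin n) → ℝ) (ρ ϑ δ a w : ℝ) (s o : ℕ) : Prop :=
  ∀ (β β' : EuclideanSpace ℝ (Fin p)) (γ γ' : EuclideanSpace ℝ (Fin n)),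
    (l0 β : ℝ) ≤ ϑ * s → l0 β' ≤ s → (l0 γ : ℝ) ≤ ϑ * o → l0 γ' ≤ o →
    a / √ϑ * (D2 β β' + D2 γ γ') ≤
      2 * a * symBreg f (fit ((1 / √ρ) • X) β γ) (fit ((1 / √ρ) • X) β' γ')
        + w * breg f (fit ((1 / √ρ) • X) β γ) (fit ((1 / √ρ) • X) β' γ')
        - δ * D2 (fit ((1 / √ρ) • X) β γ) (fit ((1 / √ρ) • X) β' γ')

end ResistantLearning

end

/-!
The argument has a deterministic half and a probabilistic half, which meet in a quadratic inequality
for `x = ‖X β̂ + γ̂ - η*‖`, where `η* = X β* + γ*`.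

*Optimality.* At a fixed point of quantile thresholding the gradient vanishes on the selected
entries and is small off them, in comparison with the smallest selected entry. As there are at least
`ϑ` selected entries outside the true support for each true entry that was missed, this gives
`⟨∇, b - c⟩ ≤ (r / √ϑ) D₂(b, c)` (`inner_sub_le_of_isQuantileThreshold`). Added up over `β` and `γ`,
the right-hand side is what the regularity condition absorbs, and
`δ D₂ ≤ a ⟨ε, X β̂ + γ̂ - η*⟩ + w Δ_l` remains (`mul_D2_fit_le`). The first part has
`w = 0`. For the second part, the updates never increase the loss (`IsReachedFrom.loss_le`), so
`Δ_l` at the limit point is at most `D₂` at the starting point plus two noise terms (`breg_le_of_loss_le`).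

*Noise.* Every fitted difference lies in one of `(p choose qβ) (n choose qγ)` subspaces of dimension
at most `2 (qβ + qγ)`, so `⟨ε, ·⟩` is at most the largest projected noise norm times `x`. Writing
`exp(|v|² / 2)` as an average of `exp ⟨v, g⟩` over a standard Gaussian vector `g` reduces the
exponential moment of the projected norm to one-dimensional marginals, and the `ψ₂` bound on these
gives `E exp(‖P ε‖² / (2 τ²)) ≤ 2 · 2^(dim / 2)` for all `τ > σ`
(`lintegral_exp_norm_sq_starProjection_le`). The coordinates of `ε` may be dependent. Summing
the exponential moments over the subspaces bounds the expected maximum by `4 riskRate` (`exists_noise_envelope`).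

Solving the quadratic inequality, integrating and letting `τ ↓ σ` completes the proof; the limit in
`τ` also covers `σ = 0`.
-/

namespace ResistantLearning

open MeasureTheory ProbabilityTheory

/-! ### Quantile thresholding -/

theorem D2_eq_sum {d : ℕ} (a b : EuclideanSpace ℝ (Fin d)) :
    D2 a b = (∑ i, (a i - b i) ^ 2) / 2 := by
  simp [D2, EuclideanSpace.norm_sq_eq]

/-- First-order optimality of a fixed point `b` of quantile thresholding against a sparser vector
`c`. Only entries of `c` that `b` misses contribute to the inner product, and keeping `ϑ` times
as many entries as `c` has leaves at least `ϑ` spare entries of `b` for each of them. This is the source of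
the factor `1 / √ϑ`. -/
theorem inner_sub_le_of_isQuantileThreshold {d q : ℕ} {b c g : EuclideanSpace ℝ (Fin d)} {r ϑ : ℝ}
    (hr : 0 < r) (hϑ : 1 ≤ ϑ) (hq : (q : ℝ) = ϑ * l0 c) (hqd : q ≤ d)
    (h : IsQuantileThreshold (b - (1 / r) • g) q b) :
    inner ℝ g (b - c) ≤ r / √ϑ * D2 b c := by
  classical
  obtain ⟨J, hJ, hmax, hin, hout⟩ := h
  rw [min_eq_left hqd] at hJ
  have hg : ∀ i ∈ J, g i = 0 := by
    intro i hi
    have h1 := hin i hi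
    have h2 : r⁻¹ ≠ 0 := inv_ne_zero hr.ne'
    simp only [PiLp.sub_apply, PiLp.smul_apply, smul_eq_mul, one_div] at h1
    exact (mul_eq_zero.1 (by linarith : r⁻¹ * g i = 0)).resolve_left h2
  set S := Finset.univ.filter fun i => c i ≠ 0 with hS
  set A := S \ J with hA
  set B := J \ S with hB
  have hcS : ∀ i ∉ S, c i = 0 := by
    intro i hi; simpa [hS] using hi
  -- `A` holds the missed entries of `c` and `B` the spare entries of `b`. From `|J| = ϑ |S|`,
  -- removing the common part `S ∩ J` on both sides gives `|B| ≥ ϑ |A|`, because `ϑ ≥ 1`.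
  have hcard : ϑ * A.card ≤ B.card := by
    have h1 : (A.card : ℝ) + (S ∩ J).card = S.card := by
      exact_mod_cast Finset.card_sdiff_add_card_inter S J
    have h2 : (B.card : ℝ) + (J ∩ S).card = J.card := by
      exact_mod_cast Finset.card_sdiff_add_card_inter J S
    rw [Finset.inter_comm] at h2
    have h3 : (J.card : ℝ) = ϑ * S.card := by rw [hJ, hq]; rfl
    nlinarith [(Nat.cast_nonneg (S ∩ J).card : (0 : ℝ) ≤ _)]
  have hinner : inner ℝ g (b - c) = ∑ i ∈ A, -(g i * c i) := by
    rw [PiLp.inner_apply, ← Finset.sum_subset (Finset.subset_univ A)]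
    · refine Finset.sum_congr rfl fun i hi => ?_
      have : i ∉ J := (Finset.mem_sdiff.1 hi).2
      simp [hout i this]; ring
    · intro i _ hi
      by_cases hiJ : i ∈ J
      · simp [hg i hiJ]
      · have : i ∉ S := fun h => hi (Finset.mem_sdiff.2 ⟨h, hiJ⟩)
        simp [hout i hiJ, hcS i this]
  have hD : (∑ i ∈ A, c i ^ 2 + ∑ i ∈ B, b i ^ 2) / 2 ≤ D2 b c := by
    rw [D2_eq_sum]
    have hdisj : Disjoint A B := by
      rw [Finset.disjoint_left]
      intro i hi hi'
      exact (Finset.mem_sdiff.1 hi).2 (Finset.mem_sdiff.1 hi').1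
    have e : ∑ i ∈ A, c i ^ 2 + ∑ i ∈ B, b i ^ 2 = ∑ i ∈ A ∪ B, (b i - c i) ^ 2 := by
      rw [Finset.sum_union hdisj]
      congr 1 <;> refine Finset.sum_congr rfl fun i hi => ?_
      · simp [hout i (Finset.mem_sdiff.1 hi).2]
      · simp [hcS i (Finset.mem_sdiff.1 hi).2]
    rw [e]
    have := Finset.sum_le_sum_of_subset_of_nonneg (Finset.subset_univ (A ∪ B))
      (f := fun i => (b i - c i) ^ 2) (fun i _ _ => sq_nonneg _)
    linarith
  have hϑ0 : 0 < √ϑ := Real.sqrt_pos.2 (by linarith)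
  have hsq : √ϑ ^ 2 = ϑ := Real.sq_sqrt (by linarith)
  have hr' : 0 ≤ r / √ϑ := by positivity
  rcases B.eq_empty_or_nonempty with hBe | hBn
  · have hA0 : A = ∅ := by
      rw [hBe] at hcard
      have h0 : (A.card : ℝ) ≤ 0 := by
        simp at hcard
        nlinarith [(Nat.cast_nonneg A.card : (0 : ℝ) ≤ _)]
      exact Finset.card_eq_zero.1 (by exact_mod_cast le_antisymm h0 (Nat.cast_nonneg _))
    rw [hinner, hA0, Finset.sum_empty]
    exact mul_nonneg hr' (by unfold D2; positivity)
  -- With `|b k|` smallest on `B`, the gradient off `J` is at most `r |b k|`, and Young's inequality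
  -- with weight `√ϑ` distributes each term between `A` and the spare entries.
  · obtain ⟨k, hk, hkmin⟩ := B.exists_min_image (fun i => |b i|) hBn
    have hkJ := (Finset.mem_sdiff.1 hk).1
    have hgk : ∀ j ∈ A, |g j| ≤ r * |b k| := by
      intro j hj
      have hj := (Finset.mem_sdiff.1 hj).2
      have h1 := hmax k hkJ j hj
      rw [← hin k hkJ] at h1
      simp only [PiLp.sub_apply, PiLp.smul_apply, hout j hj, zero_sub, smul_eq_mul, abs_neg,
        abs_mul, abs_of_pos (one_div_pos.2 hr)] at h1
      rw [one_div, inv_mul_le_iff₀ hr] at h1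
      exact h1
    have hterm : ∀ j ∈ A, -(g j * c j) ≤ r / √ϑ * ((ϑ * b k ^ 2 + c j ^ 2) / 2) := by
      intro j hj
      have h1 : -(g j * c j) ≤ |g j| * |c j| := by
        rw [← abs_mul]; exact neg_le_abs _
      have h2 : |g j| * |c j| ≤ r * |b k| * |c j| :=
        mul_le_mul_of_nonneg_right (hgk j hj) (abs_nonneg _)
      have h3 : r * |b k| * |c j| = r / √ϑ * (√ϑ * |b k| * |c j|) := by
        field_simp
      have h4 : √ϑ * |b k| * |c j| ≤ (ϑ * b k ^ 2 + c j ^ 2) / 2 := by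
        have h5 := sq_nonneg (√ϑ * |b k| - |c j|)
        rw [sub_sq, mul_pow, hsq, sq_abs, sq_abs] at h5
        linarith
      calc _ ≤ _ := h1.trans h2
        _ = _ := h3
        _ ≤ _ := mul_le_mul_of_nonneg_left h4 hr'
    have hBsum : (B.card : ℝ) * b k ^ 2 ≤ ∑ i ∈ B, b i ^ 2 := by
      simpa using Finset.card_nsmul_le_sum B (fun i => b i ^ 2) (b k ^ 2)
        fun i hi => sq_le_sq.2 (hkmin i hi)
    rw [hinner]
    refine (Finset.sum_le_sum hterm).trans ?_
    rw [← Finset.mul_sum]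
    refine mul_le_mul_of_nonneg_left (le_trans ?_ hD) hr'
    rw [← Finset.sum_div, Finset.sum_add_distrib, Finset.sum_const, nsmul_eq_mul]
    nlinarith [mul_le_mul_of_nonneg_right hcard (sq_nonneg (b k))]

theorem l0_le_of_isQuantileThreshold {d q : ℕ} {s t : EuclideanSpace ℝ (Fin d)}
    (h : IsQuantileThreshold s q t) : l0 t ≤ q := by
  obtain ⟨J, hJ, -, -, hout⟩ := h
  refine (Finset.card_le_card (t := J) fun i hi => ?_).trans (hJ.le.trans (min_le_left _ _))
  by_contra hi'
  simp [hout i hi'] at hi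

/-- Quantile thresholding is a Euclidean projection onto the vectors with at most `q` nonzero
entries. -/
theorem IsQuantileThreshold.norm_sub_le {d q : ℕ} {s t b : EuclideanSpace ℝ (Fin d)}
    (h : IsQuantileThreshold s q t) (hb : l0 b ≤ q) : ‖t - s‖ ^ 2 ≤ ‖b - s‖ ^ 2 := by
  classical
  obtain ⟨J, hJ, hmax, hin, hout⟩ := h
  set S := Finset.univ.filter fun i => b i ≠ 0 with hS
  have hbS : ∀ i ∉ S, b i = 0 := by
    intro i hi; simpa [hS] using hi
  have hSJ : S.card ≤ J.card := by
    rw [hJ]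
    exact le_min hb ((Finset.card_le_univ S).trans (by simp))
  have hcard : (S \ J).card ≤ (J \ S).card := by
    have h1 := Finset.card_sdiff_add_card_inter S J
    have h2 := Finset.card_sdiff_add_card_inter J S
    rw [Finset.inter_comm] at h2
    omega
  -- Every entry of `s` on `J \ S` is at least as large as every entry on `S \ J`.
  have hexch : ∑ i ∈ S \ J, s i ^ 2 ≤ ∑ i ∈ J \ S, s i ^ 2 := by
    rcases (J \ S).eq_empty_or_nonempty with he | hn
    · have : S \ J = ∅ := Finset.card_eq_zero.1 (by rw [he] at hcard; simpa using hcard)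
      simp [he, this]
    · obtain ⟨k, hk, hkmin⟩ := (J \ S).exists_min_image (fun i => |s i|) hn
      have h1 : ∑ i ∈ S \ J, s i ^ 2 ≤ (S \ J).card * s k ^ 2 := by
        simpa using Finset.sum_le_card_nsmul (S \ J) (fun i => s i ^ 2) (s k ^ 2)
          fun i hi => sq_le_sq.2 (hmax k (Finset.mem_sdiff.1 hk).1 i (Finset.mem_sdiff.1 hi).2)
      have h2 : ((J \ S).card : ℝ) * s k ^ 2 ≤ ∑ i ∈ J \ S, s i ^ 2 := by
        simpa using Finset.card_nsmul_le_sum (J \ S) (fun i => s i ^ 2) (s k ^ 2)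
          fun i hi => sq_le_sq.2 (hkmin i hi)
      have h3 : ((S \ J).card : ℝ) * s k ^ 2 ≤ (J \ S).card * s k ^ 2 := by gcongr
      linarith
  have hcompl : ∑ i ∈ Jᶜ, s i ^ 2 ≤ ∑ i ∈ Sᶜ, s i ^ 2 := by
    have e1 := Finset.sum_add_sum_compl J fun i => s i ^ 2
    have e2 := Finset.sum_add_sum_compl S fun i => s i ^ 2
    have e3 := Finset.sum_inter_add_sum_sdiff J S fun i => s i ^ 2
    have e4 := Finset.sum_inter_add_sum_sdiff S J fun i => s i ^ 2
    rw [Finset.inter_comm] at e3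
    linarith
  have ht : ‖t - s‖ ^ 2 = ∑ i ∈ Jᶜ, s i ^ 2 := by
    rw [EuclideanSpace.norm_sq_eq, ← Finset.sum_add_sum_compl J, Finset.sum_eq_zero, zero_add]
    · refine Finset.sum_congr rfl fun i hi => ?_
      simp [hout i (Finset.mem_compl.1 hi)]
    · intro i hi
      simp [hin i hi]
  have hb' : ∑ i ∈ Sᶜ, s i ^ 2 ≤ ‖b - s‖ ^ 2 := by
    rw [EuclideanSpace.norm_sq_eq, ← Finset.sum_add_sum_compl S]
    have e : ∑ i ∈ Sᶜ, ‖(b - s) i‖ ^ 2 = ∑ i ∈ Sᶜ, s i ^ 2 := by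
      refine Finset.sum_congr rfl fun i hi => ?_
      simp [hbS i (Finset.mem_compl.1 hi)]
    rw [e]
    exact le_add_of_nonneg_left (by positivity)
  linarith

/-- A thresholded gradient step does not increase the quadratic model of the loss, since the
starting point is itself feasible. -/
theorem IsQuantileThreshold.inner_add_le_zero {d q : ℕ} {b b' g : EuclideanSpace ℝ (Fin d)} {r : ℝ}
    (hr : 0 < r) (h : IsQuantileThreshold (b - (1 / r) • g) q b') (hb : l0 b ≤ q) :
    inner ℝ g (b' - b) + r * ‖b' - b‖ ^ 2 / 2 ≤ 0 := by
  have h1 := h.norm_sub_le hb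
  rw [show b' - (b - (1 / r) • g) = (b' - b) + (1 / r) • g by abel, sub_sub_cancel,
    norm_add_sq_real, inner_smul_right, real_inner_comm] at h1
  have h2 : ‖b' - b‖ ^ 2 + 2 * (1 / r * inner ℝ g (b' - b)) ≤ 0 := by linarith
  have h3 := mul_le_mul_of_nonneg_left h2 hr.le
  have h4 : r * (‖b' - b‖ ^ 2 + 2 * (1 / r * inner ℝ g (b' - b)))
      = 2 * (inner ℝ g (b' - b) + r * ‖b' - b‖ ^ 2 / 2) := by
    field_simp; ring
  linarith

/-! ### Losses with Lipschitz gradient -/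

/-- The descent lemma. -/
theorem breg_le_D2 {n : ℕ} {f : EuclideanSpace ℝ (Fin n) → ℝ} (hf : Differentiable ℝ f)
    (hL : ∀ a b, ‖gradient f a - gradient f b‖ ≤ ‖a - b‖) (a b : EuclideanSpace ℝ (Fin n)) :
    breg f a b ≤ D2 a b := by
  set v := a - b with hv
  -- The gap along the segment from `b` to `a`; its derivative is nonpositive on `[0, 1]`.
  let φ : ℝ → ℝ := fun t => f (b + t • v) - t * inner ℝ (gradient f b) v - t ^ 2 * ‖v‖ ^ 2 / 2
  have hφ : ∀ t, HasDerivAt φ (inner ℝ (gradient f (b + t • v)) v - inner ℝ (gradient f b) v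
      - t * ‖v‖ ^ 2) t := by
    intro t
    have hline : HasDerivAt (fun t : ℝ => b + t • v) v t := by
      simpa using ((hasDerivAt_id t).smul_const v).const_add b
    have h1 := (hf (b + t • v)).hasGradientAt.hasFDerivAt.comp_hasDerivAt t hline
    have h2 := (hasDerivAt_id t).mul_const (inner ℝ (gradient f b) v)
    have h3 := ((hasDerivAt_pow 2 t).mul_const (‖v‖ ^ 2)).div_const 2
    refine ((h1.sub h2).sub h3).congr_deriv ?_
    simp
    ring
  have hanti : AntitoneOn φ (Set.Icc 0 1) := by
    refine antitoneOn_of_deriv_nonpos (convex_Icc 0 1)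
      (fun t _ => (hφ t).continuousAt.continuousWithinAt)
      (fun t _ => (hφ t).differentiableAt.differentiableWithinAt) fun t ht => ?_
    rw [interior_Icc] at ht
    rw [(hφ t).deriv, ← inner_sub_left]
    have h1 := real_inner_le_norm (gradient f (b + t • v) - gradient f b) v
    have h2 := hL (b + t • v) b
    rw [add_sub_cancel_left, norm_smul, Real.norm_of_nonneg ht.1.le] at h2
    nlinarith [norm_nonneg v]
  have h := hanti (Set.left_mem_Icc.2 zero_le_one) (Set.right_mem_Icc.2 zero_le_one) zero_le_one
  simp only [φ, one_smul, zero_smul, add_zero, hv, add_sub_cancel] at h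
  simp only [breg, D2]
  linarith

theorem two_mul_symBreg {n : ℕ} (f : EuclideanSpace ℝ (Fin n) → ℝ)
    (a b : EuclideanSpace ℝ (Fin n)) :
    2 * symBreg f a b = inner ℝ (gradient f a) (a - b) - inner ℝ (gradient f b) (a - b) := by
  have : inner ℝ (gradient f a) (b - a) = - inner ℝ (gradient f a) (a - b) := by
    rw [← inner_neg_right, neg_sub]
  simp only [symBreg, breg, this]
  ring

/-! ### Monotonicity of alternating algorithms -/

theorem fit_sub {n p : ℕ} (X : Matrix (Fin n) (Fin p) ℝ) (β β' : EuclideanSpace ℝ (Fin p))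
    (γ γ' : EuclideanSpace ℝ (Fin n)) :
    fit X β γ - fit X β' γ' = fit X (β - β') (γ - γ') := by
  simp only [fit, map_sub]
  abel

theorem inner_toEuclideanLin_transpose {n p : ℕ} (X : Matrix (Fin n) (Fin p) ℝ)
    (g : EuclideanSpace ℝ (Fin n)) (b : EuclideanSpace ℝ (Fin p)) :
    inner ℝ (Matrix.toEuclideanLin X.transpose g) b = inner ℝ g (Matrix.toEuclideanLin X b) := by
  rw [← Matrix.conjTranspose_eq_transpose_of_trivial,
    Matrix.toEuclideanLin_conjTranspose_eq_adjoint,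
    LinearMap.adjoint_inner_left]

theorem l0_sub_le {d : ℕ} (a b : EuclideanSpace ℝ (Fin d)) : l0 (a - b) ≤ l0 a + l0 b := by
  classical
  refine (Finset.card_le_card fun i hi => ?_).trans (Finset.card_union_le _ _)
  simp only [Finset.mem_union, Finset.mem_filter, Finset.mem_univ, true_and] at hi ⊢
  by_contra! h
  simp [h.1, h.2] at hi

theorem le_of_breg_le_D2 {n : ℕ} {f : EuclideanSpace ℝ (Fin n) → ℝ} (hf : Differentiable ℝ f)
    (hL : ∀ a b, ‖gradient f a - gradient f b‖ ≤ ‖a - b‖) {a b : EuclideanSpace ℝ (Fin n)}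
    (h : inner ℝ (gradient f b) (a - b) + ‖a - b‖ ^ 2 / 2 ≤ 0) : f a ≤ f b := by
  have := breg_le_D2 hf hL a b
  simp only [breg, D2] at this
  linarith

/-- Every update preserves feasibility and does not increase the loss. Feasibility of the current
iterate is needed, since exact minimization and thresholding are compared with staying put. -/
theorem Update.feasible_and_le {n p qβ qγ : ℕ} {X : Matrix (Fin n) (Fin p) ℝ}
    {f : EuclideanSpace ℝ (Fin n) → ℝ} (hf : Differentiable ℝ f)
    (hL : ∀ a b, ‖gradient f a - gradient f b‖ ≤ ‖a - b‖)
    {z z' : EuclideanSpace ℝ (Fin p) × EuclideanSpace ℝ (Fin n)} (h : Update X f qβ qγ z z')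
    (hβ : l0 z.1 ≤ qβ) (hγ : l0 z.2 ≤ qγ) :
    l0 z'.1 ≤ qβ ∧ l0 z'.2 ≤ qγ ∧ f (fit X z'.1 z'.2) ≤ f (fit X z.1 z.2) := by
  cases h with
  | betaMin β β' γ hs hmin => exact ⟨hs, hγ, hmin β hβ⟩
  | gammaMin β γ γ' hs hmin => exact ⟨hβ, hs, hmin γ hγ⟩
  | betaThreshold β β' γ r hr hrip h =>
    have hs := l0_le_of_isQuantileThreshold h
    refine ⟨hs, hγ, le_of_breg_le_D2 hf hL ?_⟩
    have h1 := h.inner_add_le_zero hr hβ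
    have h2 := hrip (β' - β) ((l0_sub_le _ _).trans (by simp at hβ; omega))
    rw [inner_toEuclideanLin_transpose] at h1
    have e : fit X β' γ - fit X β γ = Matrix.toEuclideanLin X (β' - β) := by
      simp [fit]
    simp only [e]
    linarith
  | gammaThreshold β γ γ' h =>
    have hs := l0_le_of_isQuantileThreshold h
    refine ⟨hβ, hs, le_of_breg_le_D2 hf hL ?_⟩
    have h1 := IsQuantileThreshold.inner_add_le_zero (g := gradient f (fit X β γ)) one_pos
      (by simpa using h) hγ
    have e : fit X β γ' - fit X β γ = γ' - γ := by
      simp [fit]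
    simp only [e]
    linarith
  | monotone β β' γ γ' hβ' hγ' hle => exact ⟨hβ', hγ', hle⟩

theorem continuous_fit {n p : ℕ} (X : Matrix (Fin n) (Fin p) ℝ) :
    Continuous fun z : EuclideanSpace ℝ (Fin p) × EuclideanSpace ℝ (Fin n) => fit X z.1 z.2 :=
  ((Matrix.toEuclideanLin X).continuous_of_finiteDimensional.comp continuous_fst).add
    continuous_snd

theorem IsReachedFrom.loss_le {n p qβ qγ : ℕ} {X : Matrix (Fin n) (Fin p) ℝ}
    {f : EuclideanSpace ℝ (Fin n) → ℝ} (hf : Differentiable ℝ f)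
    (hL : ∀ a b, ‖gradient f a - gradient f b‖ ≤ ‖a - b‖)
    {β₀ β : EuclideanSpace ℝ (Fin p)} {γ₀ γ : EuclideanSpace ℝ (Fin n)}
    (h : IsReachedFrom X f qβ qγ β₀ γ₀ β γ) (hβ : l0 β₀ ≤ qβ) (hγ : l0 γ₀ ≤ qγ) :
    f (fit X β γ) ≤ f (fit X β₀ γ₀) := by
  obtain ⟨z, hz0, hz, hcl⟩ := h
  have hinv : ∀ t, l0 (z t).1 ≤ qβ ∧ l0 (z t).2 ≤ qγ ∧
      f (fit X (z t).1 (z t).2) ≤ f (fit X β₀ γ₀) := by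
    intro t
    induction t with
    | zero => simp [hz0, hβ, hγ]
    | succ t ih =>
      obtain ⟨h1, h2, h3⟩ := (hz t).feasible_and_le hf hL ih.1 ih.2.1
      exact ⟨h1, h2, h3.trans ih.2.2⟩
  have hclosed : IsClosed {w : EuclideanSpace ℝ (Fin p) × EuclideanSpace ℝ (Fin n) |
      f (fit X w.1 w.2) ≤ f (fit X β₀ γ₀)} :=
    isClosed_le (hf.continuous.comp (continuous_fit X)) continuous_const
  by_contra hne
  obtain ⟨t, ht⟩ := (mapClusterPt_iff_frequently.1 hcl _ (hclosed.isOpen_compl.mem_nhds hne)).exists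
  exact ht (hinv t).2.2

/-! ### Exponential moments of projected sub-Gaussian vectors -/

theorem lintegral_exp_mul_gaussianReal (t : ℝ) :
    ∫⁻ g, ENNReal.ofReal (Real.exp (t * g)) ∂gaussianReal 0 1
      = ENNReal.ofReal (Real.exp (t ^ 2 / 2)) := by
  rw [← ofReal_integral_eq_lintegral_ofReal (integrable_exp_mul_gaussianReal t)
    (ae_of_all _ fun _ => (Real.exp_pos _).le)]
  have := congrFun (mgf_fun_id_gaussianReal (μ := 0) (v := 1)) t
  simp only [mgf] at this
  rw [this]
  simp

theorem lintegral_exp_sq_div_four_gaussianReal :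
    ∫⁻ g, ENNReal.ofReal (Real.exp (g ^ 2 / 4)) ∂gaussianReal 0 1 = ENNReal.ofReal √2 := by
  rw [gaussianReal_of_var_ne_zero _ one_ne_zero,
    lintegral_withDensity_eq_lintegral_mul _ (measurable_gaussianPDF _ _) (by fun_prop)]
  have h : ∀ g : ℝ, (gaussianPDF 0 1 * fun g => ENNReal.ofReal (Real.exp (g ^ 2 / 4))) g
      = ENNReal.ofReal ((√(2 * Real.pi))⁻¹ * Real.exp (-(1 / 4) * g ^ 2)) := by
    intro g
    rw [Pi.mul_apply, gaussianPDF, ← ENNReal.ofReal_mul (gaussianPDFReal_nonneg _ _ _),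
      gaussianPDFReal, mul_assoc, ← Real.exp_add]
    congr 2
    · simp
    · congr 1
      simp
      ring
  rw [lintegral_congr h, ← ofReal_integral_eq_lintegral_ofReal, integral_const_mul,
    integral_gaussian]
  · congr 1
    rw [← Real.sqrt_inv, ← Real.sqrt_mul (by positivity)]
    congr 1
    field_simp
    norm_num
  · exact (integrable_exp_neg_mul_sq (by norm_num)).const_mul _
  · exact ae_of_all _ fun _ => by positivity

/-- Tonelli's theorem for a product of functions of single coordinates. -/
theorem lintegral_pi_prod {ι : Type*} [Fintype ι] (ν : Measure ℝ) [IsProbabilityMeasure ν]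
    (f : ι → ℝ → ENNReal) (hf : ∀ i, Measurable (f i)) :
    ∫⁻ x, ∏ i, f i (x i) ∂Measure.pi (fun _ : ι => ν) = ∏ i, ∫⁻ g, f i g ∂ν := by
  have hind : iIndepFun (fun i (x : ι → ℝ) => f i (x i)) (Measure.pi fun _ : ι => ν) :=
    iIndepFun_pi fun i => (hf i).aemeasurable
  rw [lintegral_prod_eq_prod_lintegral_of_indepFun _ _ hind
    fun i => (hf i).comp (measurable_pi_apply i)]
  refine Finset.prod_congr rfl fun i _ => ?_
  exact (measurePreserving_eval (fun _ : ι => ν) i).lintegral_comp (hf i)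

/-- Exponential moment of the squared norm of a projected sub-Gaussian vector. The coordinates of
the projection may be dependent: `exp(|v|² / 2)` is the Gaussian average of `exp ⟨v, g⟩`, and after
exchanging the two expectations only the one-dimensional marginal in the direction `∑ gₖ bₖ`
occurs. -/
theorem lintegral_exp_norm_sq_starProjection_le {Ω : Type*} [MeasurableSpace Ω] {μ : Measure Ω}
    [IsProbabilityMeasure μ] {n : ℕ} {ε : Ω → EuclideanSpace ℝ (Fin n)} (hε : AEMeasurable ε μ)
    {τ : ℝ} (hτ : 0 < τ)
    (hψ : ∀ a : EuclideanSpace ℝ (Fin n),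
      ∫⁻ ω, ENNReal.ofReal (Real.exp (inner ℝ (ε ω) a ^ 2 / (τ * ‖a‖) ^ 2)) ∂μ ≤ 2)
    (V : Submodule ℝ (EuclideanSpace ℝ (Fin n))) :
    ∫⁻ ω, ENNReal.ofReal (Real.exp (‖V.starProjection (ε ω)‖ ^ 2 / (2 * τ ^ 2))) ∂μ
      ≤ 2 * ENNReal.ofReal √2 ^ Module.finrank ℝ V := by
  set b := stdOrthonormalBasis ℝ V with hb
  set γ : Measure (Fin (Module.finrank ℝ V) → ℝ) := Measure.pi fun _ => gaussianReal 0 1 with hγ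
  let v : Fin (Module.finrank ℝ V) → Ω → ℝ :=
    fun k ω => inner ℝ (ε ω) (b k : EuclideanSpace ℝ _) / τ
  have hv : ∀ k, AEMeasurable (v k) μ := fun k => (hε.inner aemeasurable_const).div_const τ
  have hnorm : ∀ ω, ‖V.starProjection (ε ω)‖ ^ 2 / (2 * τ ^ 2) = ∑ k, v k ω ^ 2 / 2 := by
    intro ω
    have h1 : ‖V.starProjection (ε ω)‖ ^ 2 = ∑ k, inner ℝ (ε ω) (b k : EuclideanSpace ℝ _) ^ 2 := by
      rw [Submodule.starProjection_apply, ← Submodule.coe_norm, ← b.sum_sq_inner_left]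
      refine Finset.sum_congr rfl fun k _ => ?_
      rw [Submodule.inner_orthogonalProjectionOnto_eq_of_mem_right]
    rw [h1, Finset.sum_div]
    refine Finset.sum_congr rfl fun k _ => ?_
    simp only [v]
    field_simp
  have hlin : ∀ ω, ENNReal.ofReal (Real.exp (‖V.starProjection (ε ω)‖ ^ 2 / (2 * τ ^ 2)))
      = ∫⁻ g, ∏ k, ENNReal.ofReal (Real.exp (v k ω * g k)) ∂γ := by
    intro ω
    rw [hnorm, Real.exp_sum, ENNReal.ofReal_prod_of_nonneg fun _ _ => (Real.exp_pos _).le, hγ,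
      lintegral_pi_prod (gaussianReal 0 1) (fun k g => ENNReal.ofReal (Real.exp (v k ω * g)))
        fun k => by fun_prop]
    exact Finset.prod_congr rfl fun k _ => (lintegral_exp_mul_gaussianReal _).symm
  -- `x ≤ x² / A² + A² / 4` with `x = ⟨ε, a⟩ / τ` and `A = ‖a‖`: the first term is controlled by the
  -- `ψ₂` bound, the second has the finite Gaussian moment `√2` in each coordinate.
  have hpt : ∀ (g : Fin (Module.finrank ℝ V) → ℝ) (ω : Ω),
      ∏ k, ENNReal.ofReal (Real.exp (v k ω * g k)) ≤
        ENNReal.ofReal (Real.exp (inner ℝ (ε ω) (∑ k, g k • b k : V).1 ^ 2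
          / (τ * ‖(∑ k, g k • b k : V).1‖) ^ 2)) *
          ∏ k, ENNReal.ofReal (Real.exp (g k ^ 2 / 4)) := by
    intro g ω
    set a : V := ∑ k, g k • b k with ha
    have hin : ∑ k, v k ω * g k = inner ℝ (ε ω) a.1 / τ := by
      simp only [ha, v, AddSubmonoidClass.coe_finsetSum, Submodule.coe_smul, inner_sum,
        inner_smul_right, Finset.sum_div]
      exact Finset.sum_congr rfl fun k _ => by ring
    have hna : ∑ k, g k ^ 2 / 4 = ‖a.1‖ ^ 2 / 4 := by
      rw [← Submodule.coe_norm, ← b.sum_sq_inner_right, Finset.sum_div]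
      refine Finset.sum_congr rfl fun k _ => ?_
      rw [ha, b.orthonormal.inner_right_fintype]
    rw [← ENNReal.ofReal_prod_of_nonneg fun _ _ => (Real.exp_pos _).le,
      ← ENNReal.ofReal_prod_of_nonneg fun _ _ => (Real.exp_pos _).le, ← Real.exp_sum,
      ← Real.exp_sum, ← ENNReal.ofReal_mul (Real.exp_pos _).le, ← Real.exp_add, hin, hna]
    refine ENNReal.ofReal_le_ofReal (Real.exp_le_exp.2 ?_)
    rcases eq_or_ne a.1 0 with h0 | h0
    · simp [h0]
    · have hpos : 0 < ‖a.1‖ := norm_pos_iff.2 h0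
      have h2 := sq_nonneg (inner ℝ (ε ω) a.1 / (τ * ‖a.1‖) - ‖a.1‖ / 2)
      have h3 : (inner ℝ (ε ω) a.1 / (τ * ‖a.1‖) - ‖a.1‖ / 2) ^ 2
          = inner ℝ (ε ω) a.1 ^ 2 / (τ * ‖a.1‖) ^ 2 + ‖a.1‖ ^ 2 / 4 - inner ℝ (ε ω) a.1 / τ := by
        field_simp
        ring
      linarith
  rw [lintegral_congr hlin, lintegral_lintegral_swap]
  · calc ∫⁻ g, ∫⁻ ω, ∏ k, ENNReal.ofReal (Real.exp (v k ω * g k)) ∂μ ∂γ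
        ≤ ∫⁻ g, 2 * ∏ k, ENNReal.ofReal (Real.exp (g k ^ 2 / 4)) ∂γ := by
          refine lintegral_mono fun g => (lintegral_mono (hpt g)).trans ?_
          rw [lintegral_mul_const']
          · exact mul_le_mul_left (hψ _) _
          · exact ENNReal.prod_ne_top fun _ _ => ENNReal.ofReal_ne_top
      _ = 2 * ENNReal.ofReal √2 ^ Module.finrank ℝ V := by
          rw [lintegral_const_mul' _ _ (by simp), hγ,
            lintegral_pi_prod _ (fun _ g => ENNReal.ofReal (Real.exp (g ^ 2 / 4)))
              fun k => by fun_prop]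
          simp [lintegral_exp_sq_div_four_gaussianReal]
  · refine Finset.aemeasurable_fun_prod _ fun k _ => ?_
    refine ENNReal.measurable_ofReal.comp_aemeasurable (Real.measurable_exp.comp_aemeasurable ?_)
    exact ((hv k).comp_fst).mul (((measurable_pi_apply k).comp measurable_snd).aemeasurable)

/-- The infimum that defines the `ψ₂`-norm need not be attained, hence the strict inequality. -/
theorem lintegral_exp_sq_div_le_two_of_psi2Norm_lt {Ω : Type*} [MeasurableSpace Ω] {μ : Measure Ω}
    {ξ : Ω → ℝ} {τ : ℝ} (h : psi2Norm μ ξ < ENNReal.ofReal τ) :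
    ∫⁻ ω, ENNReal.ofReal (Real.exp (ξ ω ^ 2 / τ ^ 2)) ∂μ ≤ 2 := by
  simp only [psi2Norm, iInf_lt_iff] at h
  obtain ⟨K, hK, hK2, hlt⟩ := h
  have hKτ : K < τ := (ENNReal.ofReal_lt_ofReal_iff_of_nonneg hK.le).1 hlt
  refine (lintegral_mono fun ω => ENNReal.ofReal_le_ofReal (Real.exp_le_exp.2 ?_)).trans hK2
  gcongr

theorem IsSubGaussianVector.lintegral_exp_le {Ω : Type*} [MeasurableSpace Ω] {μ : Measure Ω}
    [IsProbabilityMeasure μ] {n : ℕ} {ε : Ω → EuclideanSpace ℝ (Fin n)} {σ τ : ℝ}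
    (h : IsSubGaussianVector μ ε σ) (hσ : 0 ≤ σ) (hτ : σ < τ) (a : EuclideanSpace ℝ (Fin n)) :
    ∫⁻ ω, ENNReal.ofReal (Real.exp (inner ℝ (ε ω) a ^ 2 / (τ * ‖a‖) ^ 2)) ∂μ ≤ 2 := by
  -- For `a = 0` the exponent is `0 / 0 = 0`.
  rcases eq_or_ne a 0 with rfl | ha
  · simp
  · have hpos : 0 < ‖a‖ := norm_pos_iff.2 ha
    refine lintegral_exp_sq_div_le_two_of_psi2Norm_lt ((h.scale a).trans_lt ?_)
    exact (ENNReal.ofReal_lt_ofReal_iff_of_nonneg (by positivity)).2 (by gcongr)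

/-- Maximal inequality for finitely many variables with exponential moments. The maximum is replaced
by the larger function `c (L + ∑ exp(Z i / c - L))`, which dominates every `Z i` because
`x ≤ exp x`, and whose integral is immediate. -/
theorem exists_integrable_bound_of_lintegral_exp_le {Ω ι : Type*} [MeasurableSpace Ω]
    {μ : Measure Ω} [IsProbabilityMeasure μ] (s : Finset ι) (Z : ι → Ω → ℝ)
    (hZ : ∀ i ∈ s, AEMeasurable (Z i) μ) {c B L : ℝ} (hc : 0 < c)
    (hB : ∀ i ∈ s, ∫⁻ ω, ENNReal.ofReal (Real.exp (Z i ω / c)) ∂μ ≤ ENNReal.ofReal B)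
    (hL : s.card * B ≤ Real.exp L) (hB0 : 0 ≤ B) :
    ∃ M : Ω → ℝ, Integrable M μ ∧ ∫ ω, M ω ∂μ ≤ c * (L + 1) ∧ ∀ i ∈ s, ∀ ω, Z i ω ≤ M ω := by
  have hint : ∀ i ∈ s, Integrable (fun ω => Real.exp (Z i ω / c)) μ := by
    intro i hi
    refine ⟨(Real.measurable_exp.comp_aemeasurable
      ((hZ i hi).div_const c)).aestronglyMeasurable, ?_⟩
    rw [hasFiniteIntegral_iff_ofReal (ae_of_all _ fun _ => (Real.exp_pos _).le)]
    exact (hB i hi).trans_lt ENNReal.ofReal_lt_top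
  have hle : ∀ i ∈ s, ∫ ω, Real.exp (Z i ω / c) ∂μ ≤ B := by
    intro i hi
    have h := hB i hi
    rwa [← ofReal_integral_eq_lintegral_ofReal (hint i hi)
      (ae_of_all _ fun _ => (Real.exp_pos _).le), ENNReal.ofReal_le_ofReal_iff hB0] at h
  have hsum : Integrable (fun ω => ∑ i ∈ s, Real.exp (-L) * Real.exp (Z i ω / c)) μ :=
    integrable_finsetSum _ fun i hi => (hint i hi).const_mul _
  refine ⟨fun ω => c * (L + ∑ i ∈ s, Real.exp (-L) * Real.exp (Z i ω / c)),
    ((integrable_const L).add hsum).const_mul c, ?_, fun i hi ω => ?_⟩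
  · rw [integral_const_mul, integral_add (integrable_const L) hsum,
      integral_finsetSum _ fun i hi => (hint i hi).const_mul _]
    refine mul_le_mul_of_nonneg_left ?_ hc.le
    simp only [integral_const, probReal_univ, one_smul, integral_const_mul, ← Finset.mul_sum]
    have h1 : ∑ i ∈ s, ∫ ω, Real.exp (Z i ω / c) ∂μ ≤ s.card * B := by
      simpa using Finset.sum_le_card_nsmul s _ B hle
    have h2 : Real.exp (-L) * ∑ i ∈ s, ∫ ω, Real.exp (Z i ω / c) ∂μ ≤ Real.exp (-L) * Real.exp L :=
      mul_le_mul_of_nonneg_left (h1.trans hL) (Real.exp_pos _).le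
    rw [← Real.exp_add, neg_add_cancel, Real.exp_zero] at h2
    linarith
  · have h1 : Real.exp (-L) * Real.exp (Z i ω / c) ≤
        ∑ i ∈ s, Real.exp (-L) * Real.exp (Z i ω / c) :=
      Finset.single_le_sum (f := fun i => Real.exp (-L) * Real.exp (Z i ω / c))
        (fun _ _ => by positivity) hi
    rw [← Real.exp_add] at h1
    have h2 := Real.add_one_le_exp (-L + Z i ω / c)
    have h3 : Z i ω / c ≤ L + ∑ i ∈ s, Real.exp (-L) * Real.exp (Z i ω / c) := by linarith
    rwa [div_le_iff₀' hc] at h3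

/-! ### The noise over all sparse models -/

theorem choose_le_exp_mul_log (p q : ℕ) :
    (p.choose q : ℝ) ≤ Real.exp (q * Real.log (Real.exp 1 * p / q)) := by
  rcases Nat.eq_zero_or_pos q with rfl | hq
  · simp
  rcases Nat.eq_zero_or_pos p with rfl | hp
  · rw [Nat.choose_eq_zero_of_lt hq]
    simp
  have hq' : (0 : ℝ) < q := by exact_mod_cast hq
  have hp' : (0 : ℝ) < p := by exact_mod_cast hp
  have hpos : 0 < Real.exp 1 * p / q := by positivity
  rw [mul_comm, Real.exp_mul, Real.exp_log hpos, Real.rpow_natCast]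
  have h1 : (p.choose q : ℝ) ≤ (p : ℝ) ^ q / q.factorial := Nat.choose_le_pow_div q p
  have h2 := Real.pow_div_factorial_le_exp (q : ℝ) hq'.le q
  calc (p.choose q : ℝ) ≤ (p : ℝ) ^ q / q.factorial := h1
    _ = (p / q : ℝ) ^ q * ((q : ℝ) ^ q / q.factorial) := by
      rw [div_pow]; field_simp
    _ ≤ (p / q : ℝ) ^ q * Real.exp q := by gcongr
    _ = (Real.exp 1 * p / q) ^ q := by
      rw [mul_div_assoc, mul_pow, ← Real.exp_nat_mul, mul_one, mul_comm]

/-- The entropy term `q log(e p / q)` dominates `q` itself, so that the dimension of a model is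
controlled by the logarithm of the number of models. -/
theorem le_mul_log {p q : ℕ} (h : q ≤ p) : (q : ℝ) ≤ q * Real.log (Real.exp 1 * p / q) := by
  rcases Nat.eq_zero_or_pos q with rfl | hq
  · simp
  have hq' : (0 : ℝ) < q := by exact_mod_cast hq
  refine le_mul_of_one_le_right hq'.le ?_
  rw [Real.le_log_iff_exp_le (by have : (q:ℝ) ≤ p := by exact_mod_cast h
                                 have : (0:ℝ) < p := by linarith
                                 positivity), mul_div_assoc]
  refine le_mul_of_one_le_right (Real.exp_pos _).le ?_
  rw [one_le_div hq']
  exact_mod_cast h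

theorem riskRate_eq (n p : ℕ) (σ u v : ℝ) : riskRate n p σ u v = σ ^ 2 * riskRate n p 1 u v := by
  simp only [riskRate]
  ring

/-- The space of fitted values `X β + γ` with `β` supported in `A` and `γ` supported in `B`, encoded
as the span of the corresponding columns of the augmented design `[X  I]`. -/
def modelSpace {n p : ℕ} (X : Matrix (Fin n) (Fin p) ℝ) (A : Finset (Fin p)) (B : Finset (Fin n)) :
    Submodule ℝ (EuclideanSpace ℝ (Fin n)) :=
  Submodule.span ℝ
    ((fun i => Matrix.toEuclideanLin X (EuclideanSpace.single i 1)) '' (A : Set (Fin p))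
      ∪ (fun j => EuclideanSpace.single j 1) '' (B : Set (Fin n)))

theorem finrank_modelSpace_le {n p : ℕ} (X : Matrix (Fin n) (Fin p) ℝ) (A : Finset (Fin p))
    (B : Finset (Fin n)) : Module.finrank ℝ (modelSpace X A B) ≤ A.card + B.card := by
  classical
  rw [modelSpace, ← Finset.coe_image, ← Finset.coe_image, ← Finset.coe_union]
  refine (finrank_span_finset_le_card _).trans ((Finset.card_union_le _ _).trans ?_)
  exact add_le_add Finset.card_image_le Finset.card_image_le

theorem eq_sum_single {d : ℕ} (v : EuclideanSpace ℝ (Fin d)) :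
    v = ∑ i, v i • EuclideanSpace.single i (1 : ℝ) := by
  have := (EuclideanSpace.basisFun (Fin d) ℝ).sum_repr v
  simpa using this.symm

theorem fit_mem_modelSpace {n p : ℕ} (X : Matrix (Fin n) (Fin p) ℝ) {A : Finset (Fin p)}
    {B : Finset (Fin n)} {β : EuclideanSpace ℝ (Fin p)} {γ : EuclideanSpace ℝ (Fin n)}
    (hβ : ∀ i ∉ A, β i = 0) (hγ : ∀ i ∉ B, γ i = 0) : fit X β γ ∈ modelSpace X A B := by
  refine Submodule.add_mem _ ?_ ?_
  · rw [eq_sum_single β, map_sum]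
    refine Submodule.sum_mem _ fun i _ => ?_
    by_cases hi : i ∈ A
    · rw [map_smul]
      exact Submodule.smul_mem _ _ (Submodule.subset_span (Or.inl ⟨i, hi, rfl⟩))
    · simp [hβ i hi]
  · rw [eq_sum_single γ]
    refine Submodule.sum_mem _ fun i _ => ?_
    by_cases hi : i ∈ B
    · exact Submodule.smul_mem _ _ (Submodule.subset_span (Or.inr ⟨i, hi, rfl⟩))
    · simp [hγ i hi]

/-- A sparse vector is supported in a set of exactly `q` indices. -/
theorem exists_card_eq_support_subset {d q : ℕ} {v : EuclideanSpace ℝ (Fin d)} (hv : l0 v ≤ q)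
    (hq : q ≤ d) : ∃ J : Finset (Fin d), J.card = q ∧ ∀ i ∉ J, v i = 0 := by
  obtain ⟨J, hJ, hJc⟩ := Finset.exists_superset_card_eq hv (by simpa using hq)
  refine ⟨J, hJc, fun i hi => ?_⟩
  by_contra h
  exact hi (hJ (by simp [h]))

theorem abs_inner_le_norm_starProjection_mul {n : ℕ} (V : Submodule ℝ (EuclideanSpace ℝ (Fin n)))
    {v : EuclideanSpace ℝ (Fin n)} (hv : v ∈ V) (e : EuclideanSpace ℝ (Fin n)) :
    |inner ℝ e v| ≤ ‖V.starProjection e‖ * ‖v‖ := by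
  have : inner ℝ e v = inner ℝ (V.starProjection e) v := by
    rw [Submodule.inner_starProjection_left_eq_right, Submodule.starProjection_eq_self_iff.2 hv]
  rw [this]
  exact abs_real_inner_le_norm _ _

/-- A single integrable `M` controls the noise in the direction of every fitted difference
`X β + γ - η*` with feasible `(β, γ)`, including the random ones. -/
theorem exists_noise_envelope {Ω : Type*} [MeasurableSpace Ω] {μ : Measure Ω}
    [IsProbabilityMeasure μ] {n p qβ qγ : ℕ} {ε : Ω → EuclideanSpace ℝ (Fin n)} {σ τ : ℝ}
    (hε : IsSubGaussianVector μ ε σ) (hσ : 0 ≤ σ) (hτ : σ < τ) (X : Matrix (Fin n) (Fin p) ℝ)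
    {βs : EuclideanSpace ℝ (Fin p)} {γs : EuclideanSpace ℝ (Fin n)}
    (hβs : l0 βs ≤ qβ) (hγs : l0 γs ≤ qγ) (hqβ : qβ ≤ p) (hqγ : qγ ≤ n) :
    ∃ M : Ω → ℝ, Integrable M μ ∧ ∫ ω, M ω ∂μ ≤ 4 * riskRate n p τ qγ qβ ∧ (∀ ω, 0 ≤ M ω) ∧
      ∀ ω β γ, l0 β ≤ qβ → l0 γ ≤ qγ →
        |inner ℝ (ε ω) (fit X β γ - fit X βs γs)| ≤ √(M ω) * ‖fit X β γ - fit X βs γs‖ := by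
  classical
  -- Models are indexed by supports of the maximal size, all enlarged by a fixed superset of the
  -- true support, so that differences from the truth stay inside.
  obtain ⟨S, hS, hβS⟩ := exists_card_eq_support_subset hβs hqβ
  obtain ⟨T, hT, hγT⟩ := exists_card_eq_support_subset hγs hqγ
  have hτ0 : 0 < τ := hσ.trans_lt hτ
  let V : Finset (Fin p) × Finset (Fin n) → Submodule ℝ (EuclideanSpace ℝ (Fin n)) :=
    fun m => modelSpace X (m.1 ∪ S) (m.2 ∪ T)
  let Z : Finset (Fin p) × Finset (Fin n) → Ω → ℝ := fun m ω => ‖(V m).starProjection (ε ω)‖ ^ 2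
  let models := Finset.powersetCard qβ (Finset.univ : Finset (Fin p)) ×ˢ
    Finset.powersetCard qγ (Finset.univ : Finset (Fin n))
  have hmem : ∀ m, m ∈ models ↔ m.1.card = qβ ∧ m.2.card = qγ := by
    intro m; simp [models]
  set a := (qβ : ℝ) * Real.log (Real.exp 1 * p / qβ) with ha
  set b := (qγ : ℝ) * Real.log (Real.exp 1 * n / qγ) with hb
  have ha' : (qβ : ℝ) ≤ a := le_mul_log hqβ
  have hb' : (qγ : ℝ) ≤ b := le_mul_log hqγ
  have hcard : (models.card : ℝ) ≤ Real.exp (a + b) := by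
    simp only [models, Finset.card_product, Finset.card_powersetCard, Finset.card_univ,
      Fintype.card_fin, Nat.cast_mul, Real.exp_add]
    exact mul_le_mul (choose_le_exp_mul_log p qβ) (choose_le_exp_mul_log n qγ)
      (Nat.cast_nonneg _) (Real.exp_pos _).le
  have htwo : (2 : ℝ) ≤ Real.exp 1 := by
    have := Real.add_one_le_exp (1 : ℝ)
    linarith
  have hB : ∀ m ∈ models, ∫⁻ ω, ENNReal.ofReal (Real.exp (Z m ω / (2 * τ ^ 2))) ∂μ
      ≤ ENNReal.ofReal (Real.exp (1 + a + b)) := by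
    intro m hm
    obtain ⟨h1, h2⟩ := (hmem m).1 hm
    refine (lintegral_exp_norm_sq_starProjection_le hε.aemeasurable hτ0
      (hε.lintegral_exp_le hσ hτ) (V m)).trans ?_
    have hrank : Module.finrank ℝ (V m) ≤ 2 * (qβ + qγ) := by
      have h3 := finrank_modelSpace_le X (m.1 ∪ S) (m.2 ∪ T)
      have h4 := Finset.card_union_le m.1 S
      have h5 := Finset.card_union_le m.2 T
      simp only [V]
      omega
    have htoReal : ∀ k : ℕ, 2 * ENNReal.ofReal √2 ^ k = ENNReal.ofReal (2 * √2 ^ k) := fun k => by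
      rw [ENNReal.ofReal_mul zero_le_two, ENNReal.ofReal_pow (Real.sqrt_nonneg _),
        ENNReal.ofReal_ofNat]
    rw [htoReal]
    refine ENNReal.ofReal_le_ofReal ?_
    calc 2 * √2 ^ Module.finrank ℝ (V m) ≤ 2 * √2 ^ (2 * (qβ + qγ)) := by
          gcongr
          exact Real.one_le_sqrt.2 (by norm_num)
      -- The dimension is at most `2 (qβ + qγ)`, which turns the powers of `√2` into powers of `2`.
      _ = 2 * 2 ^ (qβ + qγ) := by rw [pow_mul, Real.sq_sqrt (by norm_num)]
      _ ≤ Real.exp 1 * Real.exp 1 ^ (qβ + qγ) := by gcongr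
      _ = Real.exp (1 + (qβ + qγ)) := by
          rw [← Real.exp_nat_mul, ← Real.exp_add]
          push_cast
          ring_nf
      _ ≤ Real.exp (1 + a + b) := Real.exp_le_exp.2 (by linarith)
  obtain ⟨M, hMi, hM, hZM⟩ := exists_integrable_bound_of_lintegral_exp_le (μ := μ)
    models Z (fun m _ => ((V m).starProjection.continuous.measurable.comp_aemeasurable
      hε.aemeasurable).norm.pow_const 2) (c := 2 * τ ^ 2) (L := 1 + 2 * (a + b))
    (by positivity) hB (by
      refine (mul_le_mul_of_nonneg_right hcard (Real.exp_pos _).le).trans_eq ?_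
      rw [← Real.exp_add]
      ring_nf) (Real.exp_pos _).le
  obtain ⟨m₀, hm₀⟩ : models.Nonempty := ⟨(S, T), (hmem _).2 ⟨hS, hT⟩⟩
  refine ⟨M, hMi, hM.trans_eq ?_, fun ω => (sq_nonneg _).trans (hZM m₀ hm₀ ω),
    fun ω β γ hβ hγ => ?_⟩
  · simp only [riskRate, ha, hb]
    ring
  · obtain ⟨J, hJ, hβJ⟩ := exists_card_eq_support_subset hβ hqβ
    obtain ⟨J', hJ', hγJ⟩ := exists_card_eq_support_subset hγ hqγ
    have hV : fit X β γ - fit X βs γs ∈ V (J, J') := by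
      rw [fit_sub]
      refine fit_mem_modelSpace X (fun i hi => ?_) fun i hi => ?_
      · simp only [Finset.mem_union, not_or] at hi
        simp [hβJ i hi.1, hβS i hi.2]
      · simp only [Finset.mem_union, not_or] at hi
        simp [hγJ i hi.1, hγT i hi.2]
    refine (abs_inner_le_norm_starProjection_mul _ hV (ε ω)).trans ?_
    exact mul_le_mul_of_nonneg_right (Real.le_sqrt_of_sq_le (hZM (J, J') ((hmem _).2 ⟨hJ, hJ'⟩) ω))
      (norm_nonneg _)

/-! ### Consequences of the regularity condition -/

theorem l0_smul {d : ℕ} {c : ℝ} (hc : c ≠ 0) (v : EuclideanSpace ℝ (Fin d)) :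
    l0 (c • v) = l0 v := by
  simp [l0, hc]

theorem D2_smul {d : ℕ} (c : ℝ) (a b : EuclideanSpace ℝ (Fin d)) :
    D2 (c • a) (c • b) = c ^ 2 * D2 a b := by
  simp only [D2, ← smul_sub, norm_smul, mul_pow, Real.norm_eq_abs, sq_abs]
  ring

/-- The regularity condition is stated for the design `X / √ρ`; the substitution `β ↦ √ρ β` returns
to `X`. -/
theorem fit_smul {n p : ℕ} (X : Matrix (Fin n) (Fin p) ℝ) {c : ℝ} (hc : c ≠ 0)
    (β : EuclideanSpace ℝ (Fin p)) (γ : EuclideanSpace ℝ (Fin n)) :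
    fit ((1 / c) • X) (c • β) γ = fit X β γ := by
  simp [fit, hc, smul_smul]

/-- At a fixed point the regularity condition absorbs the first-order terms, and only the noise and
the weighted Bregman function remain. -/
theorem mul_D2_fit_le {n p qβ qγ : ℕ} {X : Matrix (Fin n) (Fin p) ℝ}
    {f : EuclideanSpace ℝ (Fin n) → ℝ} {ρ ϑ δ a w : ℝ}
    {βs βh : EuclideanSpace ℝ (Fin p)} {γs γh : EuclideanSpace ℝ (Fin n)}
    (hρ : 0 < ρ) (hϑ : 1 ≤ ϑ) (ha : 0 ≤ a)
    (hqβ : (qβ : ℝ) = ϑ * l0 βs) (hqγ : (qγ : ℝ) = ϑ * l0 γs)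
    (hβ : l0 βh = qβ) (hγ : l0 γh = qγ) (hqp : qβ ≤ p) (hqn : qγ ≤ n)
    (hfix : IsThresholdFixedPoint X f ρ qβ qγ βh γh)
    (hreg : RegularityCondition X f ρ ϑ δ a w (l0 βs) (l0 γs)) :
    δ * D2 (fit X βh γh) (fit X βs γs) ≤
      a * inner ℝ (-gradient f (fit X βs γs)) (fit X βh γh - fit X βs γs)
        + w * breg f (fit X βh γh) (fit X βs γs) := by
  have hρ' : √ρ ≠ 0 := (Real.sqrt_pos.2 hρ).ne'
  have h := hreg (√ρ • βh) (√ρ • βs) γh γs (by rw [l0_smul hρ', hβ, hqβ]) (by rw [l0_smul hρ'])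
    (by rw [hγ, hqγ]) le_rfl
  rw [fit_smul X hρ', fit_smul X hρ', D2_smul, Real.sq_sqrt hρ.le] at h
  have h1 := inner_sub_le_of_isQuantileThreshold hρ hϑ hqβ hqp hfix.1
  have h2 := inner_sub_le_of_isQuantileThreshold (g := gradient f (fit X βh γh)) one_pos hϑ hqγ hqn
    (by simpa using hfix.2)
  rw [inner_toEuclideanLin_transpose] at h1
  have h3 : inner ℝ (gradient f (fit X βh γh)) (fit X βh γh - fit X βs γs) ≤
      1 / √ϑ * (ρ * D2 βh βs + D2 γh γs) := by
    rw [fit_sub, fit.eq_1 X (βh - βs), inner_add_right]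
    refine (add_le_add h1 h2).trans_eq ?_
    ring
  have h4 := mul_le_mul_of_nonneg_left h3 ha
  have h5 : a * (2 * symBreg f (fit X βh γh) (fit X βs γs)) =
      a * inner ℝ (gradient f (fit X βh γh)) (fit X βh γh - fit X βs γs) -
      a * inner ℝ (gradient f (fit X βs γs)) (fit X βh γh - fit X βs γs) := by
    rw [two_mul_symBreg]; ring
  rw [inner_neg_left]
  have h6 : a / √ϑ * (ρ * D2 βh βs + D2 γh γs) = a * (1 / √ϑ * (ρ * D2 βh βs + D2 γh γs)) := by ring
  linarith

/-- If `η` has no larger loss than `η₀`, its Bregman function is bounded by the quadratic error of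
`η₀` and the noise in the directions of both points. -/
theorem breg_le_of_loss_le {n : ℕ} {f : EuclideanSpace ℝ (Fin n) → ℝ} (hf : Differentiable ℝ f)
    (hL : ∀ a b, ‖gradient f a - gradient f b‖ ≤ ‖a - b‖) {η η₀ ηs : EuclideanSpace ℝ (Fin n)}
    (h : f η ≤ f η₀) :
    breg f η ηs ≤ D2 η₀ ηs + inner ℝ (-gradient f ηs) (η - ηs)
      - inner ℝ (-gradient f ηs) (η₀ - ηs) := by
  have := breg_le_D2 hf hL η₀ ηs
  simp only [breg, inner_neg_left] at *
  linarith

/-! ### Integrating the pointwise bounds -/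

theorem sq_div_two_le_of_quadratic {δ κ m x G : ℝ} (hδ : 0 < δ)
    (h : δ * (x ^ 2 / 2) ≤ κ * (m * x) + G) :
    x ^ 2 / 2 ≤ 2 * κ ^ 2 / δ ^ 2 * m ^ 2 + 2 / δ * G := by
  have h1 := sq_nonneg (δ * x - 2 * (κ * m))
  have h2 : 2 * κ ^ 2 / δ ^ 2 * m ^ 2 + 2 / δ * G = (2 * κ ^ 2 * m ^ 2 + 2 * δ * G) / δ ^ 2 := by
    field_simp
  rw [h2, le_div_iff₀ (by positivity)]
  nlinarith

/-- Pointwise bounds by noise envelopes at all scales `τ > σ` integrate to a bound at the scale `σ`.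
The envelope may depend on `τ`. -/
theorem integrable_and_integral_le_of_forall_envelope {Ω : Type*} [MeasurableSpace Ω]
    {μ : Measure Ω} [IsProbabilityMeasure μ] {D D₀ : Ω → ℝ} {σ r k c₁ c₂ : ℝ}
    (hD : AEMeasurable D μ)
    (hD0 : ∀ ω, 0 ≤ D ω) (hD₀ : Integrable D₀ μ) (hc₁ : 0 ≤ c₁)
    (h : ∀ τ, σ < τ → ∃ M : Ω → ℝ, Integrable M μ ∧ ∫ ω, M ω ∂μ ≤ k * (τ ^ 2 * r) ∧
      ∀ᵐ ω ∂μ, D ω ≤ c₁ * M ω + c₂ * D₀ ω) :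
    Integrable D μ ∧ ∫ ω, D ω ∂μ ≤ c₁ * (k * (σ ^ 2 * r)) + c₂ * ∫ ω, D₀ ω ∂μ := by
  have hint : Integrable D μ := by
    obtain ⟨M, hM, -, hle⟩ := h (σ + 1) (by linarith)
    refine ((hM.const_mul c₁).add (hD₀.const_mul c₂)).mono' hD.aestronglyMeasurable ?_
    filter_upwards [hle] with ω hω
    rwa [Real.norm_of_nonneg (hD0 ω)]
  refine ⟨hint, ?_⟩
  have hcont : Continuous fun τ : ℝ => c₁ * (k * (τ ^ 2 * r)) + c₂ * ∫ ω, D₀ ω ∂μ := by fun_prop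
  refine ge_of_tendsto ((hcont.tendsto σ).mono_left (nhdsWithin_le_nhds (s := Set.Ioi σ))) ?_
  filter_upwards [self_mem_nhdsWithin] with τ hτ
  obtain ⟨M, hM, hMle, hle⟩ := h τ hτ
  have h1 := integral_mono_ae hint ((hM.const_mul c₁).add (hD₀.const_mul c₂)) hle
  simp only [Pi.add_apply] at h1
  rw [integral_add (hM.const_mul c₁) (hD₀.const_mul c₂), integral_const_mul,
    integral_const_mul] at h1
  have h2 := mul_le_mul_of_nonneg_left hMle hc₁
  linarith

end ResistantLearning

open MeasureTheory ResistantLearning in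
theorem theorem4 :
    ∃ C₁ : ℝ, 0 < C₁ ∧ ∀ K C₀ : ℝ, 0 < K → 0 < C₀ → ∃ C₂ : ℝ, 0 < C₂ ∧
    ∀ (n p : ℕ) (Ω : Type*) (𝓨 : Type*) [MeasurableSpace Ω] (μ : Measure Ω)
      [IsProbabilityMeasure μ]
      -- the design, the loss `l(η; y)` with 1-Lipschitz gradient, the response
      (X : Matrix (Fin n) (Fin p) ℝ) (l : EuclideanSpace ℝ (Fin n) → 𝓨 → ℝ) (y : Ω → 𝓨)
      (_ : ∀ v, Differentiable ℝ fun η => l η v)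
      (_ : ∀ v η₁ η₂, ‖gradient (fun η => l η v) η₁ - gradient (fun η => l η v) η₂‖ ≤ ‖η₁ - η₂‖)
      -- the statistical truth and its effective noise
      (βs : EuclideanSpace ℝ (Fin p)) (γs : EuclideanSpace ℝ (Fin n)) (σ : ℝ) (_ : 0 ≤ σ)
      (_ : IsSubGaussianVector μ
        (fun ω => -gradient (fun η => l η (y ω)) (fit X βs γs)) σ)
      -- the estimator
      (ρ ϑ : ℝ) (qβ qγ : ℕ) (_ : 0 < ρ) (_ : 1 ≤ ϑ)
      (_ : (qβ : ℝ) = ϑ * l0 βs) (_ : (qγ : ℝ) = ϑ * l0 γs)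
      (βh : Ω → EuclideanSpace ℝ (Fin p)) (γh : Ω → EuclideanSpace ℝ (Fin n))
      (_ : AEMeasurable βh μ) (_ : AEMeasurable γh μ)
      (_ : ∀ᵐ ω ∂μ, IsThresholdFixedPoint X (fun η => l η (y ω)) ρ qβ qγ (βh ω) (γh ω))
      (_ : ∀ᵐ ω ∂μ, l0 (βh ω) = qβ) (_ : ∀ᵐ ω ∂μ, l0 (γh ω) = qγ)
      (δ : ℝ) (_ : 0 < δ),
      -- first part
      ((∀ᵐ ω ∂μ, RegularityCondition X (fun η => l η (y ω)) ρ ϑ δ 1 0 (l0 βs) (l0 γs)) →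
        Integrable (fun ω => D2 (fit X (βh ω) (γh ω)) (fit X βs γs)) μ ∧
        ∫ ω, D2 (fit X (βh ω) (γh ω)) (fit X βs γs) ∂μ ≤
          C₁ / δ ^ 2 * riskRate n p σ (ϑ * l0 γs) (ϑ * l0 βs)) ∧
      -- second part: a good starting point relaxes the regularity condition
      (∀ (R : ℝ) (_ : 1 ≤ R)
        (β₀ : Ω → EuclideanSpace ℝ (Fin p)) (γ₀ : Ω → EuclideanSpace ℝ (Fin n))
        (_ : ∀ᵐ ω ∂μ, l0 (β₀ ω) ≤ qβ) (_ : ∀ᵐ ω ∂μ, l0 (γ₀ ω) ≤ qγ)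
        (_ : ∀ᵐ ω ∂μ,
          IsReachedFrom X (fun η => l η (y ω)) qβ qγ (β₀ ω) (γ₀ ω) (βh ω) (γh ω))
        (_ : Integrable (fun ω => D2 (fit X (β₀ ω) (γ₀ ω)) (fit X βs γs)) μ)
        (_ : ∫ ω, D2 (fit X (β₀ ω) (γ₀ ω)) (fit X βs γs) ∂μ ≤
          K * R * riskRate n p σ (ϑ * l0 γs) (ϑ * l0 βs)),
        (∀ᵐ ω ∂μ, RegularityCondition X (fun η => l η (y ω)) ρ ϑ δ (1 - 1 / R)
          (C₀ / (R * max (R * δ) 1)) (l0 βs) (l0 γs)) →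
        Integrable (fun ω => D2 (fit X (βh ω) (γh ω)) (fit X βs γs)) μ ∧
        ∫ ω, D2 (fit X (βh ω) (γh ω)) (fit X βs γs) ∂μ ≤
          C₂ / δ ^ 2 * riskRate n p σ (ϑ * l0 γs) (ϑ * l0 βs)) := by

  refine ⟨8, by norm_num, fun K C₀ hK hC₀ =>
    ⟨8 * (1 + C₀) ^ 2 + 4 * C₀ * (K + 1), by positivity, ?_⟩⟩
  intro n p Ω 𝓨 _ μ _ X l y hl hL βs γs σ hσ hε ρ ϑ qβ qγ hρ hϑ hqβ hqγ βh γh hβm hγm hfix hβh hγh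
    δ hδ
  -- The estimator has exactly `qβ` and `qγ` nonzero entries, so these numbers do not exceed the
  -- dimensions.
  obtain ⟨hqp, hqn⟩ : qβ ≤ p ∧ qγ ≤ n := by
    obtain ⟨ω, h1, h2⟩ := (hβh.and hγh).exists
    rw [← h1, ← h2]
    exact ⟨(Finset.card_le_univ _).trans (by simp), (Finset.card_le_univ _).trans (by simp)⟩
  have hsβ : l0 βs ≤ qβ := by
    have : (l0 βs : ℝ) ≤ qβ := hqβ ▸ le_mul_of_one_le_left (Nat.cast_nonneg _) hϑ
    exact_mod_cast this
  have hsγ : l0 γs ≤ qγ := by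
    have : (l0 γs : ℝ) ≤ qγ := hqγ ▸ le_mul_of_one_le_left (Nat.cast_nonneg _) hϑ
    exact_mod_cast this
  rw [← hqβ, ← hqγ]
  set r := riskRate n p 1 qγ qβ with hr
  have hrate : ∀ τ, riskRate n p τ qγ qβ = τ ^ 2 * r := fun τ => riskRate_eq n p τ qγ qβ
  have hr0 : 0 ≤ r := by
    have h1 := le_mul_log hqp
    have h2 := le_mul_log hqn
    have h3 : (0 : ℝ) ≤ qβ := Nat.cast_nonneg _
    have h4 : (0 : ℝ) ≤ qγ := Nat.cast_nonneg _
    simp only [hr, riskRate]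
    linarith
  set D : Ω → ℝ := fun ω => D2 (fit X (βh ω) (γh ω)) (fit X βs γs) with hD
  have hDm : AEMeasurable D μ :=
    ((((continuous_fit X).measurable.comp_aemeasurable (hβm.prodMk hγm)).sub_const _).norm.pow_const
      2).div_const 2
  have hD0 : ∀ ω, 0 ≤ D ω := fun ω => by simp only [hD, D2]; positivity
  have henv := fun τ (hτ : σ < τ) =>
    exists_noise_envelope hε hσ hτ X hsβ hsγ hqp hqn
  constructor
  · intro hreg
    obtain ⟨h1, h2⟩ := integrable_and_integral_le_of_forall_envelope (μ := μ) (D := D)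
      (D₀ := fun _ => 0) (σ := σ) (r := r) (k := 4) (c₁ := 2 / δ ^ 2) (c₂ := 0) hDm hD0
      (integrable_zero _ _ _) (by positivity) fun τ hτ => by
        obtain ⟨M, hM, hMle, hM0, hMε⟩ := henv τ hτ
        refine ⟨M, hM, by rwa [← hrate], ?_⟩
        filter_upwards [hfix, hβh, hγh, hreg] with ω h1 h2 h3 h4
        have h5 := mul_D2_fit_le hρ hϑ zero_le_one hqβ hqγ h2 h3 hqp hqn h1 h4
        have h6 := (le_abs_self _).trans (hMε ω _ _ h2.le h3.le)
        have h7 := sq_div_two_le_of_quadratic (κ := 1) (m := √(M ω)) (G := 0) hδ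
          (x := ‖fit X (βh ω) (γh ω) - fit X βs γs‖) (by simp only [D2] at h5; linarith)
        rw [Real.sq_sqrt (hM0 ω)] at h7
        simp only [hD, D2]
        linarith
    refine ⟨h1, h2.trans_eq ?_⟩
    rw [hrate]
    ring
  · intro R hR β₀ γ₀ hβ₀ hγ₀ hreach hint hK0 hreg
    have hR0 : 0 < R := by linarith
    set w := C₀ / (R * max (R * δ) 1) with hw
    have hmax1 : 1 ≤ max (R * δ) 1 := le_max_right _ _
    have hmax2 : R * δ ≤ max (R * δ) 1 := le_max_left _ _
    have hw0 : 0 ≤ w := by positivity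
    have hwC : w ≤ C₀ := div_le_self hC₀.le (by nlinarith)
    -- The initial error enters as `w / δ` times `K R E`; this bound removes the factor `R` and
    -- yields a second factor `1 / δ`.
    have hwR : w * R ≤ C₀ / δ := by
      have : w * R = C₀ / max (R * δ) 1 := by
        rw [hw]; field_simp
      rw [this]
      exact div_le_div_of_nonneg_left hC₀.le hδ (by nlinarith)
    have ha : 0 ≤ 1 - 1 / R := by
      rw [sub_nonneg, div_le_one hR0]; exact hR
    have ha1 : 1 - 1 / R ≤ 1 := by
      have : 0 < 1 / R := by positivity
      linarith
    obtain ⟨h1, h2⟩ := integrable_and_integral_le_of_forall_envelope (μ := μ) (D := D)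
      (D₀ := fun ω => D2 (fit X (β₀ ω) (γ₀ ω)) (fit X βs γs)) (σ := σ) (r := r) (k := 4)
      (c₁ := 2 * (1 + w) ^ 2 / δ ^ 2 + w / δ) (c₂ := 4 * w / δ) hDm hD0 hint (by positivity)
      fun τ hτ => by
        obtain ⟨M, hM, hMle, hM0, hMε⟩ := henv τ hτ
        refine ⟨M, hM, by rwa [← hrate], ?_⟩
        filter_upwards [hfix, hβh, hγh, hreg, hβ₀, hγ₀, hreach] with ω h1 h2 h3 h4 h5 h6 h7
        have h8 := mul_D2_fit_le hρ hϑ ha hqβ hqγ h2 h3 hqp hqn h1 h4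
        have h9 := breg_le_of_loss_le (hl (y ω)) (hL (y ω)) (ηs := fit X βs γs)
          (h7.loss_le (hl (y ω)) (hL (y ω)) h5 h6)
        have h10 := (le_abs_self _).trans (hMε ω _ _ h2.le h3.le)
        have h11 := (neg_le_abs _).trans (hMε ω _ _ h5 h6)
        have hsq := Real.sq_sqrt (hM0 ω)
        have h12 : √(M ω) * ‖fit X (β₀ ω) (γ₀ ω) - fit X βs γs‖ ≤
            M ω / 2 + D2 (fit X (β₀ ω) (γ₀ ω)) (fit X βs γs) := by
          have := sq_nonneg (√(M ω) - ‖fit X (β₀ ω) (γ₀ ω) - fit X βs γs‖)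
          simp only [D2]
          rw [sub_sq, hsq] at this
          linarith
        have h13 : (1 - 1 / R) * inner ℝ (-gradient (fun η => l η (y ω)) (fit X βs γs))
            (fit X (βh ω) (γh ω) - fit X βs γs) ≤
            √(M ω) * ‖fit X (βh ω) (γh ω) - fit X βs γs‖ :=
          (mul_le_mul_of_nonneg_left h10 ha).trans
            (mul_le_of_le_one_left (by positivity) ha1)
        have h14 := mul_le_mul_of_nonneg_left (h9.trans
          (show _ ≤ √(M ω) * ‖fit X (βh ω) (γh ω) - fit X βs γs‖ +
            (M ω / 2 + 2 * D2 (fit X (β₀ ω) (γ₀ ω)) (fit X βs γs)) by linarith)) hw0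
        have h15 := sq_div_two_le_of_quadratic (κ := 1 + w) (m := √(M ω))
          (G := w * (M ω / 2 + 2 * D2 (fit X (β₀ ω) (γ₀ ω)) (fit X βs γs))) hδ
          (x := ‖fit X (βh ω) (γh ω) - fit X βs γs‖) (by simp only [D2] at h8 h14 ⊢; linarith)
        rw [hsq] at h15
        refine h15.trans_eq ?_
        ring
    refine ⟨h1, h2.trans ?_⟩
    rw [hrate] at hK0 ⊢
    set E := σ ^ 2 * r with hE
    have hE0 : 0 ≤ E := by positivity
    have hw1 : w / δ ≤ C₀ / δ ^ 2 := by
      have : w ≤ C₀ / δ := (le_mul_of_one_le_right hw0 hR).trans hwR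
      calc w / δ ≤ C₀ / δ / δ := by gcongr
        _ = _ := by field_simp
    have hw2 : 4 * w / δ * ∫ ω, D2 (fit X (β₀ ω) (γ₀ ω)) (fit X βs γs) ∂μ ≤
        4 * C₀ * K / δ ^ 2 * E := by
      calc _ ≤ 4 * w / δ * (K * R * E) := by gcongr
        _ = (w * R) * (4 * K * E / δ) := by ring
        _ ≤ C₀ / δ * (4 * K * E / δ) := by gcongr
        _ = _ := by field_simp
    have hw3 : (2 * (1 + w) ^ 2 / δ ^ 2 + w / δ) * (4 * E) ≤
        (2 * (1 + C₀) ^ 2 / δ ^ 2 + C₀ / δ ^ 2) * (4 * E) := by gcongr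
    refine (add_le_add hw3 hw2).trans_eq ?_
    ring
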